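/- Theorem. Let $A$ be a normal Noetherian domain with fraction field $K$, let $f\in K[x]$ be a separable irreducible polynomial, put $L=K[x]/(f)$, and let $\overline{L}$ be a splitting field of $f$ over $K$ (the Galois closure of $L/K$). Let $B$ and $\overline{B}$ be the integral closures of $A$ in $L$ and in $\overline{L}$. Let $\mathfrak{p}\subset\mathfrak{m}$ be prime ideals of $A$ and let $\overline{\mathfrak{p}}\subset\overline{\mathfrak{m}}$ be prime ideals of $\overline{B}$ lying over $\mathfrak{p}$ and $\mathfrak{m}$ respectively. Assume that $\overline{\mathfrak{p}}$ is the unique prime ideal of $\overline{B}$ that lies over $\mathfrak{p}$ and is contained in $\overline{\mathfrak{m}}$. Let $D_{\mathfrak{m}}=\{\sigma\in\mathrm{Gal}(\overline{L}/K):\sigma(\overline{\mathfrak{m}})=\overline{\mathfrak{m}}\}$ be the decomposition group of $\overline{\mathfrak{m}}$, and for a root $\alpha$ of $f$ in $\overline{L}$ let $\phi_\alpha:L\to\overline{L}$ be the $K$-embedding sending the class of $x$ to $\alpha$. Then $$D_{\mathfrak{m}}\cdot\alpha\;\longmapsto\;\bigl(\phi_\alpha^{-1}(\overline{\mathfrak{p}})\cap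 B\,\subset\,\phi_\alpha^{-1}(\overline{\mathfrak{m}})\cap B\bigr)$$ is a well-defined bijection from the set of $D_{\mathfrak{m}}$-orbits of the roots of $f$ in $\overline{L}$ to the set of extensions of the chain $\mathfrak{p}\subset\mathfrak{m}$ to $B$, that is, the set of pairs of prime ideals $\mathfrak{p}'\subset\mathfrak{m}'$ of $B$ with $\mathfrak{p}'$ lying over $\mathfrak{p}$ and $\mathfrak{m}'$ lying over $\mathfrak{m}$. -/

import Mathlib

open Polynomial
open scoped Pointwise

/-- For a root `α` of `f` in `E`, the `K`-algebra map `K[x]/(f) → E` sending `x` to `α`. -/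
noncomputable def rootEmbedding {K E : Type*} [Field K] [Field E] [Algebra K E]
    (f : K[X]) (α : f.rootSet E) : AdjoinRoot f →ₐ[K] E :=
  AdjoinRoot.liftAlgHom f (Algebra.ofId K E) (α : E) (aeval_eq_zero_of_mem_rootSet α.2)

/-- The map `B → B̄` between the integral closures of `A` in `K[x]/(f)` and in `E` that is
induced by the embedding `K[x]/(f) → E` belonging to a root `α` of `f` in `E`. -/
noncomputable def rootEmbeddingIntegral (A : Type*) {K E : Type*} [CommRing A] [Field K] [Field E]
    [Algebra A K] [Algebra K E] [Algebra A E] [IsScalarTower A K E]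
    (f : K[X]) (α : f.rootSet E) :
    integralClosure A (AdjoinRoot f) →ₐ[A] integralClosure A E :=
  ((rootEmbedding f α).restrictScalars A).mapIntegralClosure

/-- The decomposition group `{σ ∈ Gal(E/K) : σ(Q) = Q}` of an ideal `Q` of the integral closure
of `A` in `E`. -/
def decompositionGroup {A : Type*} (K : Type*) {E : Type*} [CommRing A] [Field K] [Field E]
    [Algebra A K] [Algebra K E] [Algebra A E] [IsScalarTower A K E]
    (Q : Ideal (integralClosure A E)) : Subgroup Gal(E/K) :=
  MulAction.stabilizer Gal(E/K) Q

/-- The pairs `P' ⊆ M'` of prime ideals of `B` such that `P'` lies over `P` and `M'` lies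
over `M`: the extensions of the chain `P ⊆ M` to `B`. -/
def chainExtensions {A : Type*} [CommRing A] (P M : Ideal A)
    (B : Type*) [CommRing B] [Algebra A B] : Set (Ideal B × Ideal B) :=
  {c | c.1.IsPrime ∧ c.2.IsPrime ∧ c.1 ≤ c.2 ∧ c.1.LiesOver P ∧ c.2.LiesOver M}

section RootEmbedding

variable {A K E : Type*} [CommRing A] [Field K] [Field E]
  [Algebra A K] [Algebra K E] [Algebra A E] [IsScalarTower A K E] (f : K[X])

/-! Everything follows from transitive actions of G = Gal(E/K): on the roots of `f`; on the primes
of B̄ over a given prime of A; and, for the stabilizer of a root α, on the primes of B̄ with a given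
preimage under φ_α (`exists_stabilizer_smul_eq_of_comap_eq`). They are linked by the equivariance
φ_{σα}⁻¹(σQ) = φ_α⁻¹(Q). Uniqueness of the lower prime below `Mbar` means that an element of G
moving the top of a chain to `Mbar` moves its bottom to `Pbar`, so only the upper primes have to be
controlled. -/

theorem rootEmbedding_root (α : f.rootSet E) : rootEmbedding f α (AdjoinRoot.root f) = α :=
  AdjoinRoot.liftAlgHom_root ..

theorem rootEmbedding_smul (σ : Gal(E/K)) (α : f.rootSet E) (y : AdjoinRoot f) :
    rootEmbedding f (σ • α) y = σ (rootEmbedding f α y) := by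
  have h : rootEmbedding f (σ • α) = (σ : E →ₐ[K] E).comp (rootEmbedding f α) := by
    refine AdjoinRoot.algHom_ext ?_
    rw [AlgHom.comp_apply, rootEmbedding_root, rootEmbedding_root]
    rfl
  exact DFunLike.congr_fun h y

theorem rootEmbeddingIntegral_smul (σ : Gal(E/K)) (α : f.rootSet E)
    (y : integralClosure A (AdjoinRoot f)) :
    rootEmbeddingIntegral A f (σ • α) y = σ • rootEmbeddingIntegral A f α y :=
  Subtype.ext (rootEmbedding_smul f σ α y)

theorem comap_rootEmbeddingIntegral_smul (σ : Gal(E/K)) (α : f.rootSet E)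
    (Q : Ideal (integralClosure A E)) :
    (σ • Q).comap (rootEmbeddingIntegral A f (σ • α)) =
      Q.comap (rootEmbeddingIntegral A f α) := by
  ext y
  rw [Ideal.mem_comap, Ideal.mem_comap, rootEmbeddingIntegral_smul,
    Ideal.smul_mem_pointwise_smul_iff]

variable {f}

theorem rootEmbedding_injective (hf : Irreducible f) (α : f.rootSet E) :
    Function.Injective (rootEmbedding f α) :=
  haveI := Fact.mk hf
  (rootEmbedding f α).toRingHom.injective

theorem rootEmbeddingIntegral_injective (hf : Irreducible f) (α : f.rootSet E) :
    Function.Injective (rootEmbeddingIntegral A f α) := fun _ _ h ↦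
  Subtype.ext (rootEmbedding_injective hf α (congrArg Subtype.val h))

theorem adjoin_root_le_range_rootEmbedding [FiniteDimensional K E] (α : f.rootSet E) :
    (IntermediateField.adjoin K {(α : E)}).toSubalgebra ≤ (rootEmbedding f α).range := by
  rw [IntermediateField.adjoin_simple_toSubalgebra_of_isAlgebraic
    (Algebra.IsAlgebraic.isAlgebraic (α : E)), Algebra.adjoin_le_iff, Set.singleton_subset_iff]
  exact ⟨AdjoinRoot.root f, rootEmbedding_root f α⟩

/-- An element of the integral closure fixed by the stabilizer of a root `α` of `f` comes from
the integral closure in `K[x]/(f)`. -/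
theorem exists_rootEmbeddingIntegral_eq [FiniteDimensional K E] [IsGalois K E]
    (hf : Irreducible f) (α : f.rootSet E) (b : integralClosure A E)
    (hb : ∀ σ ∈ MulAction.stabilizer Gal(E/K) α, σ • b = b) :
    ∃ y, rootEmbeddingIntegral A f α y = b := by
  have hmem : (b : E) ∈ IntermediateField.adjoin K {(α : E)} := by
    -- By the Galois correspondence, K(α) is cut out by the automorphisms fixing it, and these
    -- stabilize α.
    rw [← IsGalois.fixedField_fixingSubgroup (IntermediateField.adjoin K {(α : E)}),
      IntermediateField.mem_fixedField_iff]
    intro σ hσ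
    refine congrArg Subtype.val (hb σ (Subtype.ext ?_))
    exact (IntermediateField.mem_fixingSubgroup_iff _ σ).1 hσ _
      (IntermediateField.mem_adjoin_simple_self K (α : E))
  obtain ⟨y, hy⟩ := adjoin_root_le_range_rootEmbedding α hmem
  have hy' : ((rootEmbedding f α).restrictScalars A) y = b := hy
  refine ⟨⟨y, ?_⟩, Subtype.ext hy⟩
  rw [mem_integralClosure_iff, ← isIntegral_algHom_iff ((rootEmbedding f α).restrictScalars A)
    (rootEmbedding_injective hf α), hy']
  exact b.2

/-- Two primes with the same preimage under the embedding given by a root `α` are conjugate under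
the stabilizer of `α`. -/
theorem exists_stabilizer_smul_eq_of_comap_eq [FiniteDimensional K E] [IsGalois K E]
    (hf : Irreducible f) (α : f.rootSet E) (Q R : Ideal (integralClosure A E))
    [Q.IsPrime] [R.IsPrime]
    (h : Q.comap (rootEmbeddingIntegral A f α) = R.comap (rootEmbeddingIntegral A f α)) :
    ∃ σ : Gal(E/K), σ • α = α ∧ R = σ • Q := by
  let : Algebra (integralClosure A (AdjoinRoot f)) (integralClosure A E) :=
    (rootEmbeddingIntegral A f α).toRingHom.toAlgebra
  let G := MulAction.stabilizer Gal(E/K) α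
  -- The stabilizer of α is Gal(E/φ_α(L)), with ring of invariants φ_α(B); a finite group is
  -- transitive on the primes over a prime of its invariants.
  have : Algebra.IsInvariant (integralClosure A (AdjoinRoot f)) (integralClosure A E) G :=
    ⟨fun b hb ↦ exists_rootEmbeddingIntegral_eq hf α b fun σ hσ ↦ hb ⟨σ, hσ⟩⟩
  have : SMulCommClass G (integralClosure A (AdjoinRoot f)) (integralClosure A E) := by
    refine ⟨fun σ y b ↦ ?_⟩
    have hy : σ • rootEmbeddingIntegral A f α y = rootEmbeddingIntegral A f α y := by
      conv_rhs => rw [← show σ.1 • α = α from σ.2]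
      exact (rootEmbeddingIntegral_smul f σ.1 α y).symm
    change σ • (rootEmbeddingIntegral A f α y * b) = rootEmbeddingIntegral A f α y * σ • b
    rw [smul_mul', hy]
  obtain ⟨σ, hσ⟩ := Algebra.IsInvariant.exists_smul_of_under_eq
    (integralClosure A (AdjoinRoot f)) (integralClosure A E) G Q R h
  exact ⟨σ, σ.2, hσ⟩

/-- Every chain of two primes of the integral closure in `K[x]/(f)` lifts along the embedding
given by a root. -/
theorem exists_chain_comap_eq (hf : Irreducible f) (α : f.rootSet E)
    (p m : Ideal (integralClosure A (AdjoinRoot f))) [p.IsPrime] [m.IsPrime] (hpm : p ≤ m) :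
    ∃ Q R : Ideal (integralClosure A E), Q.IsPrime ∧ R.IsPrime ∧ Q ≤ R ∧
      Q.comap (rootEmbeddingIntegral A f α) = p ∧ R.comap (rootEmbeddingIntegral A f α) = m := by
  let : Algebra (integralClosure A (AdjoinRoot f)) (integralClosure A E) :=
    (rootEmbeddingIntegral A f α).toRingHom.toAlgebra
  have : IsScalarTower A (integralClosure A (AdjoinRoot f)) (integralClosure A E) :=
    .of_algebraMap_eq fun a ↦ ((rootEmbeddingIntegral A f α).commutes a).symm
  have : Algebra.IsIntegral (integralClosure A (AdjoinRoot f)) (integralClosure A E) :=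
    Algebra.IsIntegral.tower_top A
  -- Lying over, as going up from the zero ideal, whose preimage is zero by injectivity.
  obtain ⟨Q, -, hQ, hQp⟩ := Ideal.exists_ideal_over_prime_of_isIntegral p
    (⊥ : Ideal (integralClosure A E)) (fun x hx ↦ by
      have : x = 0 := rootEmbeddingIntegral_injective hf α
        (((Ideal.mem_bot (R := integralClosure A E)).1 hx).trans (map_zero _).symm)
      exact this ▸ p.zero_mem)
  obtain ⟨R, hQR, hR, hRm⟩ := Ideal.exists_ideal_over_prime_of_isIntegral m Q (hQp.trans_le hpm)
  exact ⟨Q, R, hQ, hR, hQR, hQp, hRm⟩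

theorem liesOver_comap_rootEmbeddingIntegral_iff (α : f.rootSet E)
    (Q : Ideal (integralClosure A E)) (P : Ideal A) :
    (Q.comap (rootEmbeddingIntegral A f α)).LiesOver P ↔ Q.LiesOver P := by
  have h : (Q.comap (rootEmbeddingIntegral A f α)).under A = Q.under A := by
    ext a
    rw [Ideal.mem_comap, Ideal.mem_comap, Ideal.mem_comap, AlgHom.commutes]
  rw [Ideal.liesOver_iff, Ideal.liesOver_iff, h]

theorem exists_smul_eq_rootSet [Normal K E] (hf : Irreducible f) (α β : f.rootSet E) :
    ∃ σ : Gal(E/K), σ • α = β := by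
  have h (γ : f.rootSet E) := minpoly.eq_of_irreducible hf (aeval_eq_zero_of_mem_rootSet γ.2)
  obtain ⟨σ, hσ⟩ := minpoly.exists_algEquiv_of_root' (K := K) (x := (β : E)) (y := (α : E))
    (Normal.isIntegral inferInstance (α : E)).isAlgebraic
    (by rw [← h α, h β, minpoly.aeval])
  exact ⟨σ, Subtype.ext hσ⟩

end RootEmbedding

/-- A Galois-fixed element lies in K and is integral over A, hence lies in A by normality. -/
theorem isInvariant_integralClosure_of_isGalois (A K E : Type*) [CommRing A] [IsDomain A]
    [IsIntegrallyClosed A] [Field K] [Algebra A K] [IsFractionRing A K] [Field E] [Algebra K E]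
    [Algebra A E] [IsScalarTower A K E] [FiniteDimensional K E] [IsGalois K E] :
    Algebra.IsInvariant A (integralClosure A E) Gal(E/K) := by
  refine ⟨fun b hb ↦ ?_⟩
  obtain ⟨k, hk⟩ := (IsGalois.mem_range_algebraMap_iff_fixed (F := K) (b : E)).2
    fun σ ↦ congrArg Subtype.val (hb σ)
  have hint : IsIntegral A k := by
    rw [← isIntegral_algebraMap_iff (algebraMap K E).injective, hk]
    exact b.2
  obtain ⟨a, rfl⟩ := IsIntegrallyClosed.algebraMap_eq_of_integral hint
  exact ⟨a, Subtype.ext (by rw [← hk, ← IsScalarTower.algebraMap_apply]; rfl)⟩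

theorem mainTheorem7 {A K E : Type*} [CommRing A] [IsDomain A] [IsNoetherianRing A]
    [IsIntegrallyClosed A] [Field K] [Algebra A K] [IsFractionRing A K]
    (f : K[X]) (hf : Irreducible f) (hsep : f.Separable)
    [Field E] [Algebra K E] [Algebra A E] [IsScalarTower A K E] [f.IsSplittingField K E]
    (P M : Ideal A) [P.IsPrime] [M.IsPrime] (hPM : P ≤ M)
    (Pbar Mbar : Ideal (integralClosure A E)) [Pbar.IsPrime] [Mbar.IsPrime]
    (hchain : Pbar ≤ Mbar) (hP : Pbar.LiesOver P) (hM : Mbar.LiesOver M)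
    (hunique : ∀ Q : Ideal (integralClosure A E), Q.IsPrime → Q.LiesOver P → Q ≤ Mbar → Q = Pbar) :
    ∃ Φ : MulAction.orbitRel.Quotient (decompositionGroup K Mbar) (f.rootSet E) ≃
        chainExtensions P M (integralClosure A (AdjoinRoot f)),
      ∀ α : f.rootSet E,
        (Φ (Quotient.mk _ α) : Ideal (integralClosure A (AdjoinRoot f)) ×
            Ideal (integralClosure A (AdjoinRoot f))) =
          (Pbar.comap (rootEmbeddingIntegral A f α), Mbar.comap (rootEmbeddingIntegral A f α)) := by
  have : FiniteDimensional K E := IsSplittingField.finiteDimensional E f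
  have : IsGalois K E := IsGalois.of_separable_splitting_field hsep
  have : Algebra.IsInvariant A (integralClosure A E) Gal(E/K) :=
    isInvariant_integralClosure_of_isGalois A K E
  -- The only use of uniqueness: σQ is a prime over `P` inside `Mbar`.
  have hmap (σ : Gal(E/K)) (Q R : Ideal (integralClosure A E)) (hQ : Q.IsPrime)
      (hQP : Q.LiesOver P) (hQR : Q ≤ R) (hσ : σ • R = Mbar) : σ • Q = Pbar :=
    hunique _ (hQ.smul σ) (hQP.smul σ)
      (hσ ▸ Ideal.pointwise_smul_le_pointwise_smul_iff.2 hQR)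
  let F (α : f.rootSet E) : chainExtensions P M (integralClosure A (AdjoinRoot f)) :=
    ⟨(Pbar.comap (rootEmbeddingIntegral A f α), Mbar.comap (rootEmbeddingIntegral A f α)),
      inferInstance, inferInstance, Ideal.comap_mono hchain,
      (liesOver_comap_rootEmbeddingIntegral_iff α _ _).2 hP,
      (liesOver_comap_rootEmbeddingIntegral_iff α _ _).2 hM⟩
  have hF (σ : decompositionGroup K Mbar) (α : f.rootSet E) : F (σ • α) = F α := by
    have hσ : σ.1 • Mbar = Mbar := σ.2
    have hM' := comap_rootEmbeddingIntegral_smul f σ.1 α Mbar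
    have hP' := comap_rootEmbeddingIntegral_smul f σ.1 α Pbar
    rw [hσ] at hM'
    rw [hmap σ.1 Pbar Mbar inferInstance hP hchain hσ] at hP'
    exact Subtype.ext (Prod.ext hP' hM')
  let Φ : MulAction.orbitRel.Quotient (decompositionGroup K Mbar) (f.rootSet E) →
      chainExtensions P M (integralClosure A (AdjoinRoot f)) :=
    Quotient.lift F fun α β ⟨σ, hσ⟩ ↦ hσ ▸ hF σ β
  refine ⟨Equiv.ofBijective Φ ⟨?_, ?_⟩, fun α ↦ rfl⟩
  · rintro ⟨α⟩ ⟨β⟩ h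
    obtain ⟨τ, rfl⟩ := exists_smul_eq_rootSet hf β α
    have hM' : Mbar.comap (rootEmbeddingIntegral A f (τ • β)) =
        Mbar.comap (rootEmbeddingIntegral A f β) := congrArg (fun c ↦ c.1.2) h
    -- Now `Mbar` and τ`Mbar` have the same preimage under the embedding of τβ, so some σ fixing τβ
    -- sends τ`Mbar` to `Mbar`. Then στ is in the decomposition group and carries β to τβ.
    rw [← comap_rootEmbeddingIntegral_smul f τ β Mbar] at hM'
    have : (τ • Mbar).IsPrime := Ideal.IsPrime.smul τ
    obtain ⟨σ, hσ, hσM⟩ := exists_stabilizer_smul_eq_of_comap_eq hf (τ • β) _ _ hM'.symm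
    refine Quotient.sound ⟨⟨σ * τ, ?_⟩, ?_⟩
    · exact (mul_smul σ τ Mbar).trans hσM.symm
    · exact (mul_smul σ τ β).trans hσ
  · rintro ⟨⟨p, m⟩, hp, hm, hpm, hpP, hmM⟩
    have hp : p.IsPrime := hp
    have hm : m.IsPrime := hm
    obtain ⟨x, hx⟩ := (IsSplittingField.splits E f).exists_eval_eq_zero
      (by rw [degree_map]; exact hf.degree_pos.ne')
    let α : f.rootSet E := ⟨x, (mem_rootSet_of_ne hf.ne_zero).2 (by rwa [aeval_def, ← eval_map])⟩
    obtain ⟨Q, R, hQ, hR, hQR, rfl, rfl⟩ := exists_chain_comap_eq hf α p m hpm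
    have hQP := (liesOver_comap_rootEmbeddingIntegral_iff α Q P).1 hpP
    have hRM := (liesOver_comap_rootEmbeddingIntegral_iff α R M).1 hmM
    -- Move the top of the lifted chain to `Mbar`; replacing α by σα leaves the preimages in B
    -- unchanged.
    obtain ⟨σ, hσ⟩ := Algebra.IsInvariant.exists_smul_of_under_eq A (integralClosure A E)
      Gal(E/K) R Mbar (hRM.over.symm.trans hM.over)
    have hσQ := hmap σ Q R hQ hQP hQR hσ.symm
    refine ⟨Quotient.mk _ (σ • α), Subtype.ext (Prod.ext ?_ ?_)⟩
    · exact (congrArg (Ideal.comap (rootEmbeddingIntegral A f (σ • α))) hσQ.symm).trans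
        (comap_rootEmbeddingIntegral_smul f σ α Q)
    · exact (congrArg (Ideal.comap (rootEmbeddingIntegral A f (σ • α))) hσ).trans
        (comap_rootEmbeddingIntegral_smul f σ α R)
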